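/- **Setting.** Let $\mathcal N=\{1,\dots,N\}$ be a catalog, $1\le h\le N$ the cache capacity, $1\le k\le N$ the answer size, $c_f>0$ the retrieval cost, $\mathcal R$ a set of requests and $c_d:\mathcal R\times\mathcal N\to\mathbb R_{\ge 0}$ the dissimilarity cost. On the augmented catalog $\mathcal U=\{1,\dots,2N\}$ put $c(r,i)=c_d(r,i)$ for $i\le N$ and $c(r,i)=c_d(r,i-N)+c_f$ for $i>N$, and let $\pi^r$ be a permutation of $\mathcal U$ that sorts $\mathcal U$ by nondecreasing $c(r,\cdot)$. Each vector $x\in\mathbb R^N$ is extended to $\mathbb R^{2N}$ by $x_{i+N}=1-x_i$. For $x\in\{0,1\}^N$ let $$C(r,x)=\sum_{i=1}^{2N}c(r,\pi^r_i)\,x_{\pi^r_i}\,\mathbb 1\Big\{\sum_{j<i}x_{\pi^r_j}<k\Big\},\qquad G(r,x)=C(r,0)-C(r,x).$$ For fractional $y\in\mathbb R^N$ let $$G(r,y)=\sum_{i=1}^{K^r-1}\alpha^r_i\min\Big\{k-\sigma^r_i,\ \sum_{j\le i}y_{\pi^r_j}-\sigma^r_i\Big\},$$ a concave function that extends the gain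 $G(r,\cdot)$ of integral states, where $\sigma^r_i=\#\{j\le i:\pi^r_j>N\}$, $\alpha^r_i=c(r,\pi^r_{i+1})-c(r,\pi^r_i)$ and $K^r=\min\{i:\sigma^r_i=k\}$. Fix requests $r_1,\dots,r_T\in\mathcal R$ ($T\ge1$) and let $G_T=\frac1T\sum_{t=1}^TG(r_t,\cdot)$. Let $\mathcal X=\{x\in\{0,1\}^N:\sum_i x_i=h\}$ and let $x_*\in\arg\max_{x\in\mathcal X}G_T(x)$ be a best static integral allocation. Let $c_d^k$ be an upper bound on the dissimilarity cost of the $k$-th closest object of $\mathcal N$, for every request in $\mathcal R$. **Algorithm.** Given a number of iterations $\tilde T\ge1$, run mirror ascent with the negative entropy $\Phi(y)=\sum_{i=1}^N y_i\log y_i$ on $\mathcal D=\mathbb R_{>0}^N$ and learning rate $\eta=\frac1{c_d^k+c_f}\sqrt{2\log(N/h)/\tilde T}$: $y_1$ minimizes $\Phi$ over $\mathrm{conv}(\mathcal X)\cap\mathcal D$; for $t=1,\dots,\tilde T$, let $g_t$ be any subgradient at $y_t$ of the concave function $G_T$ on $\mathbb R^N$, let $z_{t+1}\in\mathcal D$ satisfy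 $\nabla\Phi(z_{t+1})=\nabla\Phi(y_t)+\eta g_t$, and let $y_{t+1}$ minimize the Bregman divergence $D_\Phi(\cdot,z_{t+1})$ over $\mathrm{conv}(\mathcal X)\cap\mathcal D$. Put $\bar y=\frac1{\tilde T}\sum_{t=1}^{\tilde T}y_t$. **Rounding.** Let $\bar x\in\{0,1\}^N$ be sampled from $\bar y$ by one of the following two schemes. * *DepRound:* while there are fractional coordinates, pick two of them, $i\ne j$ (in any way, possibly depending on the past). With $a=\min(1-y_i,y_j)$ and $b=\min(y_i,1-y_j)$, replace $(y_i,y_j)$ by $(y_i+a,y_j-a)$ with probability $\frac b{a+b}$, and by $(y_i-b,y_j+b)$ otherwise. * *Coupled Rounding:* start from a random integral state obtained from some state of $\mathrm{conv}(\mathcal X)$ by independent coin tosses (object $i$ is stored with probability $y_i$) or by DepRound. Then perform any number (possibly zero) of coupled steps between states of $\mathrm{conv}(\mathcal X)$, the last state being $\bar y$. A coupled step from $y$ to $y'$, with $\delta=y'-y$, acts independently on each coordinate of the current integral state $x$: if $x_i=1$ and $\delta_i<0$, it keeps $1$ with probability $(y_i+\delta_i)/y_i$ and otherwise sets $0$;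 if $x_i=0$ and $\delta_i>0$, it sets $1$ with probability $\delta_i/(1-y_i)$ and otherwise keeps $0$; in all other cases it leaves $x_i$ unchanged. **Claim.** For every $\epsilon>0$ there is $T_0$ such that for all $\tilde T\ge T_0$, every such run and every such rounding satisfy $$\mathbb E\left[G_T(\bar x)\right]\ \ge\ \Big(1-\frac1e-\epsilon\Big)G_T(x_*).$$ -/

import Mathlib

open scoped BigOperators

noncomputable section

/-- A similarity-caching system.  The catalog is `Fin N`; the augmented catalog is
`Fin N ⊕ Fin N`, where `Sum.inl o` is object `o` served by the cache and `Sum.inr o` is object `o`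
served by the remote server. -/
structure SimilarityCache (R : Type*) (N : ℕ) where
  /-- cache capacity -/
  h : ℕ
  /-- number of objects in the answer to a request -/
  k : ℕ
  /-- cost of retrieving one object from the server -/
  cf : ℝ
  /-- dissimilarity cost -/
  cd : R → Fin N → ℝ
  /-- `ord r i`, for `1 ≤ i ≤ 2 N`, is the `i`-th closest element of the augmented catalog to `r`
  (ties are broken arbitrarily; the values at other `i` are irrelevant) -/
  ord : R → ℕ → Fin N ⊕ Fin N
  one_le_h : 1 ≤ h
  h_le : h ≤ N
  one_le_k : 1 ≤ k
  k_le : k ≤ N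
  cf_pos : 0 < cf
  cd_nonneg : ∀ r o, 0 ≤ cd r o
  ord_bijOn : ∀ r, Set.BijOn (ord r) (Set.Icc 1 (2 * N)) Set.univ
  ord_monotoneOn : ∀ r,
    MonotoneOn (fun i => Sum.elim (cd r) (fun o => cd r o + cf) (ord r i)) (Set.Icc 1 (2 * N))

/-- The augmented vector `(y, 1 - y)` of a (possibly fractional) allocation `y`. -/
def augment {N : ℕ} (y : Fin N → ℝ) : Fin N ⊕ Fin N → ℝ :=
  Sum.elim y (fun o => 1 - y o)

/-- The 0-1 vector of an integral allocation (`b i = true` iff object `i` is stored). -/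
def boolVec {N : ℕ} (b : Fin N → Bool) : Fin N → ℝ := fun i => if b i then 1 else 0

namespace SimilarityCache

variable {R : Type*} {N : ℕ} (S : SimilarityCache R N)

/-- Overall cost `c(r, u)` of serving the element `u` of the augmented catalog. -/
def cost (r : R) : Fin N ⊕ Fin N → ℝ :=
  Sum.elim (S.cd r) (fun o => S.cd r o + S.cf)

/-- Total cost `C(r, x)` of serving `r` in the augmented cache state `x`: the answer consists of
the first `k` available elements in the order `ord r`. -/
def serviceCost (r : R) (x : Fin N ⊕ Fin N → ℝ) : ℝ :=
  ∑ i ∈ Finset.Icc 1 (2 * N), S.cost r (S.ord r i) * x (S.ord r i) *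
    (if ∑ j ∈ Finset.Ico 1 i, x (S.ord r j) < (S.k : ℝ) then 1 else 0)

/-- Caching gain `G(r, x)` of an integral allocation: the cost with an empty cache minus the cost
with allocation `x`. -/
def gain (r : R) (b : Fin N → Bool) : ℝ :=
  S.serviceCost r (augment (fun _ => 0)) - S.serviceCost r (augment (boolVec b))

/-- Time-averaged caching gain `G_T` of an integral allocation. -/
def avgGain {T : ℕ} (r : Fin T → R) (b : Fin N → Bool) : ℝ :=
  (1 / (T : ℝ)) * ∑ t, S.gain (r t) b

/-- `σ^r_i`: how many of the `i` closest elements are server copies. -/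
def sigma (r : R) (i : ℕ) : ℕ := ((Finset.Icc 1 i).filter (fun j => (S.ord r j).isRight)).card

/-- `K^r`: the least index `i` with `σ^r_i = k`. -/
def lastIdx (r : R) : ℕ := sInf {i | i ∈ Set.Icc 1 (2 * N) ∧ S.sigma r i = S.k}

/-- `α^r_i`: difference between the `(i+1)`-th and the `i`-th smallest cost. -/
def alpha (r : R) (i : ℕ) : ℝ := S.cost r (S.ord r (i + 1)) - S.cost r (S.ord r i)

/-- The concave extension `G(r, y)` of the caching gain to fractional allocations. -/
def fracGain (r : R) (y : Fin N → ℝ) : ℝ :=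
  ∑ i ∈ Finset.Ico 1 (S.lastIdx r), S.alpha r i *
    min ((S.k : ℝ) - S.sigma r i)
      (∑ j ∈ Finset.Icc 1 i, augment y (S.ord r j) - S.sigma r i)

/-- Time-averaged caching gain `G_T` of a fractional allocation. -/
def avgFracGain {T : ℕ} (r : Fin T → R) (y : Fin N → ℝ) : ℝ :=
  (1 / (T : ℝ)) * ∑ t, S.fracGain (r t) y

/-- `b` is a valid integral allocation: exactly `h` objects are stored. -/
def IsCacheState (b : Fin N → Bool) : Prop := ∑ i, boolVec b i = (S.h : ℝ)

/-- The convex hull of the valid integral allocations. -/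
def fracStates : Set (Fin N → ℝ) := convexHull ℝ (boolVec '' {b | S.IsCacheState b})

/-- `b` is a best static integral allocation for the request sequence `r`. -/
def IsBestStatic {T : ℕ} (r : Fin T → R) (b : Fin N → Bool) : Prop :=
  S.IsCacheState b ∧ ∀ b', S.IsCacheState b' → S.avgGain r b' ≤ S.avgGain r b

/-- `c` bounds the dissimilarity cost of the `k`-th closest object, for every request. -/
def IsKthDissimilarityBound (c : ℝ) : Prop :=
  ∀ r, S.k ≤ (Finset.univ.filter (fun o => S.cd r o ≤ c)).card

end SimilarityCache

/-- `g` is a subgradient at `y` of the concave function `F` (i.e. a supergradient). -/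
def IsConcaveSubgradient {N : ℕ} (F : (Fin N → ℝ) → ℝ) (y g : Fin N → ℝ) : Prop :=
  ∀ u, F u ≤ F y + ∑ i, g i * (u i - y i)

/-- Bregman divergence `D_Φ(u, v)`. -/
def bregman {N : ℕ} (Φ : (Fin N → ℝ) → ℝ) (u v : Fin N → ℝ) : ℝ :=
  Φ u - Φ v - fderiv ℝ Φ v (u - v)

/-- The negative entropy mirror map. -/
def negEntropy {N : ℕ} (y : Fin N → ℝ) : ℝ := ∑ i, y i * Real.log (y i)

/-- The domain of the negative entropy mirror map. -/
def posOrthant (N : ℕ) : Set (Fin N → ℝ) := {y | ∀ i, 0 < y i}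

/-- `n` iterations of mirror ascent with mirror map `Φ` on `D`, decision set `Y`, constant learning
rate `η`, operating at each iteration with a subgradient `g t` of the concave objective `F`.  The
primal iterates are `y 1, …, y (n + 1)`, and `z (t + 1)` is the point before the projection. -/
structure IsMirrorAscentRun {N : ℕ} (Φ : (Fin N → ℝ) → ℝ) (D Y : Set (Fin N → ℝ)) (η : ℝ)
    (F : (Fin N → ℝ) → ℝ) (n : ℕ) (y z g : ℕ → Fin N → ℝ) : Prop where
  init_mem : y 1 ∈ Y ∩ D
  init_min : IsMinOn Φ (Y ∩ D) (y 1)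
  subgradient : ∀ t ∈ Set.Icc 1 n, IsConcaveSubgradient F (y t) (g t)
  dual_mem : ∀ t ∈ Set.Icc 1 n, z (t + 1) ∈ D
  dual_step : ∀ t ∈ Set.Icc 1 n, ∀ v : Fin N → ℝ,
    fderiv ℝ Φ (z (t + 1)) v = fderiv ℝ Φ (y t) v + η * ∑ i, g t i * v i
  proj_mem : ∀ t ∈ Set.Icc 1 n, y (t + 1) ∈ Y ∩ D
  proj_min : ∀ t ∈ Set.Icc 1 n, IsMinOn (fun u => bregman Φ u (z (t + 1))) (Y ∩ D) (y (t + 1))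

/-- The average `(1/n) (y 1 + ⋯ + y n)`. -/
def averageIterate {N : ℕ} (n : ℕ) (y : ℕ → Fin N → ℝ) : Fin N → ℝ :=
  fun i => (1 / (n : ℝ)) * ∑ t ∈ Finset.Icc 1 n, y t i

/-- A coin that shows `true` with probability `q` (only used with `0 ≤ q ≤ 1`). -/
def coin (q : ℝ) : PMF Bool :=
  PMF.ofFintype (fun b => if b then min (ENNReal.ofReal q) 1 else 1 - min (ENNReal.ofReal q) 1)
    (by simp)

/-- Independent coins, the `i`-th one showing `true` with probability `q i`. -/
def independentCoins {N : ℕ} (q : Fin N → ℝ) : PMF (Fin N → Bool) :=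
  PMF.ofFintype (fun b => ∏ i, coin (q i) (b i)) (by
    have hsum : ∀ i, ∑ b : Bool, coin (q i) b = 1 := fun i => by
      rw [← tsum_fintype (L := .unconditional Bool)]; exact (coin (q i)).tsum_coe
    rw [← Fintype.prod_sum (fun i b => coin (q i) b)]
    simp only [hsum, Finset.prod_const_one])

/-- `IsDepRound y μ`: `μ` is the law of the output of dependent rounding on `y`.  While some
coordinates are fractional, two of them are picked (arbitrarily, possibly depending on the past) and
simplified: with `a = min (1 - y i) (y j)` and `b = min (y i) (1 - y j)`, the pair `(y i, y j)`
becomes `(y i + a, y j - a)` with probability `b / (a + b)`, and `(y i - b, y j + b)` with the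
complementary probability `a / (a + b)`. -/
inductive IsDepRound {N : ℕ} : (Fin N → ℝ) → PMF (Fin N → Bool) → Prop
  | done (b : Fin N → Bool) : IsDepRound (boolVec b) (PMF.pure b)
  | simplify (y : Fin N → ℝ) (i j : Fin N) (a b : ℝ) (μ ν : PMF (Fin N → Bool))
      (hij : i ≠ j) (hi : y i ∈ Set.Ioo (0 : ℝ) 1) (hj : y j ∈ Set.Ioo (0 : ℝ) 1)
      (ha : a = min (1 - y i) (y j)) (hb : b = min (y i) (1 - y j))
      (hμ : IsDepRound (Function.update (Function.update y i (y i + a)) j (y j - a)) μ)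
      (hν : IsDepRound (Function.update (Function.update y i (y i - b)) j (y j + b)) ν) :
      IsDepRound y ((coin (b / (a + b))).bind (fun c => if c then μ else ν))

/-- In coupled rounding from `y` to `y'`, the probability that an object is stored next, given
whether it is stored now (`s`), where `p = y i` and `p' = y' i`. -/
def coupledProb (s : Bool) (p p' : ℝ) : ℝ :=
  if s = true ∧ p' - p < 0 then (p + (p' - p)) / p
  else if s = false ∧ 0 < p' - p then (p' - p) / (1 - p)
  else if s then 1 else 0

/-- Coupled rounding: the random next state, given the current integral state `x` and the current
and next fractional states `y`, `y'`. -/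
def coupledRounding {N : ℕ} (x : Fin N → Bool) (y y' : Fin N → ℝ) : PMF (Fin N → Bool) :=
  independentCoins (fun i => coupledProb (x i) (y i) (y' i))

/-- `IsCoupledSample Y y μ`: `μ` is the law of a state sampled from `y ∈ Y` through coupled
rounding, i.e. by any number of coupled rounding steps through fractional states in `Y`, started
from a state obtained by independent coin tosses or by dependent rounding. -/
inductive IsCoupledSample {N : ℕ} (Y : Set (Fin N → ℝ)) :
    (Fin N → ℝ) → PMF (Fin N → Bool) → Prop
  | coins (y : Fin N → ℝ) (hy : y ∈ Y) : IsCoupledSample Y y (independentCoins y)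
  | depRound (y : Fin N → ℝ) (hy : y ∈ Y) (μ : PMF (Fin N → Bool)) (hμ : IsDepRound y μ) :
      IsCoupledSample Y y μ
  | step (y y' : Fin N → ℝ) (hy' : y' ∈ Y) (μ : PMF (Fin N → Bool)) (hμ : IsCoupledSample Y y μ) :
      IsCoupledSample Y y' (μ.bind (fun x => coupledRounding x y y'))

/-- Expectation of `f` under the law `μ` of a random integral allocation. -/
def expectation {N : ℕ} (μ : PMF (Fin N → Bool)) (f : (Fin N → Bool) → ℝ) : ℝ :=
  ∑ b, (μ b).toReal * f b

end

/-!
Both rounding schemes produce a random state that is at least as good as independent coins for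
every submodular function, in mean (`DominatesCoins`).  For dependent rounding this holds because
the multilinear extension of a submodular function is convex along `e i - e j`
(`multilinearExt_le_of_simplify`); a coupled step keeps it because re-randomizing each coordinate by
a monotone kernel preserves submodularity (`IsPairwiseSubmodular.comp_kernel`), while the kernels of
the step carry the means `q` to the means `q'` (`coupledProb_mean`).

The gain of a request is a nonnegative combination of functions `min m (∑ o ∈ I, x o)` with `m ≥ 1`
an integer (`SimilarityCache.fracGain_eq`).  Summation by parts of the service cost shows that this
holds for integral states too (`SimilarityCache.gain_eq_fracGain`).  These functions are submodular,
and independent coins with parameters `q` give them a mean of at least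
`(1 - 1 / e) * min m (∑ o ∈ I, q o)`: a further coin of parameter `q l` multiplies the gap between
`m` and the mean by at most `1 - q l / m ≤ exp (-q l / m)`
(`multilinearExt_truncatedCount_correlation_gap`).  Hence rounding loses at most a factor
`1 - 1 / e` of the concave extension (`SimilarityCache.expectation_avgGain_ge`).

It remains that the averaged iterate maximizes the concave extension up to an error tending to `0`
(`IsMirrorAscentRun.le_averageIterate`).  This is the usual telescoping of Bregman divergences.
Only the order `1 / √n` of the error matters, so crude constants suffice: supergradients are bounded
by some Lipschitz constant of the objective, and on the unit cube the entropic divergence dominates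
a quarter of the squared Euclidean distance.  The additive error is then compared with the optimum,
which is fixed; an optimum equal to `0` is trivial because gains are nonnegative.
-/

noncomputable section

/-! ### The multilinear extension -/

/-- Probability that a Bernoulli variable of parameter `q` takes the value `c`. -/
def bernoulliWeight (q : ℝ) (c : Bool) : ℝ := if c then q else 1 - q

lemma bernoulliWeight_nonneg {q : ℝ} (hq : q ∈ Set.Icc (0 : ℝ) 1) (c : Bool) :
    0 ≤ bernoulliWeight q c := by
  cases c <;> simp [bernoulliWeight, hq.1, hq.2]

/-- The multilinear extension of a set function `f` at `q`: the mean of `f` when the `i`-th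
coordinate is `true` with probability `q i`, independently.  It is a polynomial in `q`, so `q` need
not lie in the unit cube. -/
def multilinearExt {N : ℕ} (f : (Fin N → Bool) → ℝ) (q : Fin N → ℝ) : ℝ :=
  ∑ b, (∏ i, bernoulliWeight (q i) (b i)) * f b

section multilinearExt

variable {N : ℕ}

lemma multilinearExt_mono {f f' : (Fin N → Bool) → ℝ} {q : Fin N → ℝ}
    (hq : ∀ i, q i ∈ Set.Icc (0 : ℝ) 1) (h : ∀ b, f b ≤ f' b) :
    multilinearExt f q ≤ multilinearExt f' q :=
  Finset.sum_le_sum fun b _ => mul_le_mul_of_nonneg_left (h b)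
    (Finset.prod_nonneg fun i _ => bernoulliWeight_nonneg (hq i) _)

lemma multilinearExt_const (a : ℝ) (q : Fin N → ℝ) :
    multilinearExt (fun _ => a) q = a := by
  have h : ∑ b : Fin N → Bool, ∏ i, bernoulliWeight (q i) (b i) = 1 := by
    rw [← Fintype.prod_sum (fun i c => bernoulliWeight (q i) c)]
    simp [bernoulliWeight]
  rw [multilinearExt, ← Finset.sum_mul, h, one_mul]

lemma multilinearExt_add (f f' : (Fin N → Bool) → ℝ) (q : Fin N → ℝ) :
    multilinearExt (fun b => f b + f' b) q = multilinearExt f q + multilinearExt f' q := by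
  simp only [multilinearExt, mul_add, Finset.sum_add_distrib]

lemma multilinearExt_const_mul (a : ℝ) (f : (Fin N → Bool) → ℝ) (q : Fin N → ℝ) :
    multilinearExt (fun b => a * f b) q = a * multilinearExt f q := by
  simp only [multilinearExt, Finset.mul_sum]
  exact Finset.sum_congr rfl fun b _ => by ring

/-- Changing the parameter of one coordinate amounts to averaging that coordinate out. -/
lemma multilinearExt_update (f : (Fin N → Bool) → ℝ) (q : Fin N → ℝ) (i : Fin N) (p : ℝ) :
    multilinearExt f (Function.update q i p) =
      multilinearExt (fun b => p * f (Function.update b i true) +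
        (1 - p) * f (Function.update b i false)) q := by
  have hsymm : ∀ (c : Bool) (b : {j // j ≠ i} → Bool) (c' : Bool),
      Function.update ((Equiv.funSplitAt i Bool).symm (c, b)) i c' =
        (Equiv.funSplitAt i Bool).symm (c', b) := by
    intro c b c'
    ext j
    by_cases h : j = i
    · subst h; simp [Equiv.funSplitAt, Equiv.piSplitAt]
    · simp [Equiv.funSplitAt, Equiv.piSplitAt, h]
  have hprod : ∀ (q : Fin N → ℝ) (c : Bool) (b : {j // j ≠ i} → Bool),
      ∏ j, bernoulliWeight (q j) ((Equiv.funSplitAt i Bool).symm (c, b) j) =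
        bernoulliWeight (q i) c * ∏ j : {j // j ≠ i}, bernoulliWeight (q j) (b j) := by
    intro q c b
    rw [Fintype.prod_eq_mul_prod_subtype_ne _ i]
    congr 1
    · simp [Equiv.funSplitAt, Equiv.piSplitAt]
    · refine Finset.prod_congr rfl fun j _ => ?_
      simp [Equiv.funSplitAt, Equiv.piSplitAt, j.2]
  have hupd : ∀ b : {j // j ≠ i} → Bool,
      ∏ j : {j // j ≠ i}, bernoulliWeight (Function.update q i p j) (b j) =
        ∏ j : {j // j ≠ i}, bernoulliWeight (q j) (b j) := by
    intro b
    refine Finset.prod_congr rfl fun j _ => ?_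
    rw [Function.update_of_ne j.2]
  simp only [multilinearExt]
  rw [← (Equiv.funSplitAt i Bool).symm.sum_comp, ← (Equiv.funSplitAt i Bool).symm.sum_comp,
    Fintype.sum_prod_type, Fintype.sum_prod_type]
  simp only [hprod, hsymm, hupd, Fintype.sum_bool, Function.update_self]
  rw [← Finset.sum_add_distrib, ← Finset.sum_add_distrib]
  refine Finset.sum_congr rfl fun b _ => ?_
  simp only [bernoulliWeight]
  simp
  ring

lemma multilinearExt_update_update (f : (Fin N → Bool) → ℝ) (q : Fin N → ℝ) (i j : Fin N)
    (p p' : ℝ) :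
    multilinearExt f (Function.update (Function.update q i p) j p') =
      multilinearExt (fun b =>
        p * (p' * f (Function.update (Function.update b i true) j true) +
          (1 - p') * f (Function.update (Function.update b i true) j false)) +
        (1 - p) * (p' * f (Function.update (Function.update b i false) j true) +
          (1 - p') * f (Function.update (Function.update b i false) j false))) q := by
  rw [multilinearExt_update, multilinearExt_update]

/-- The law of independent coins whose parameters are themselves random and independent is that of
independent coins with the averaged parameters. -/
lemma multilinearExt_comp (f : (Fin N → Bool) → ℝ) (q : Fin N → ℝ) (p : Fin N → Bool → ℝ) :
    multilinearExt (fun x => multilinearExt f (fun i => p i (x i))) q =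
      multilinearExt f (fun i => q i * p i true + (1 - q i) * p i false) := by
  simp only [multilinearExt, Finset.mul_sum]
  rw [Finset.sum_comm]
  refine Finset.sum_congr rfl fun b _ => ?_
  have h : ∀ i, bernoulliWeight (q i * p i true + (1 - q i) * p i false) (b i) =
      ∑ c, bernoulliWeight (q i) c * bernoulliWeight (p i c) (b i) := by
    intro i
    rw [Fintype.sum_bool]
    cases b i <;> simp [bernoulliWeight]
    ring
  simp only [h]
  rw [Fintype.prod_sum (fun i c => bernoulliWeight (q i) c * bernoulliWeight (p i c) (b i)),
    Finset.sum_mul]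
  refine Finset.sum_congr rfl fun x _ => ?_
  rw [Finset.prod_mul_distrib]
  ring

end multilinearExt

/-! ### Submodular functions and rounding -/

/-- Submodularity of a set function, in its local form: raising two distinct coordinates has
decreasing returns. -/
def IsPairwiseSubmodular {N : ℕ} (f : (Fin N → Bool) → ℝ) : Prop :=
  ∀ (b : Fin N → Bool) (i j : Fin N), i ≠ j →
    f (Function.update (Function.update b i true) j true) +
      f (Function.update (Function.update b i false) j false) ≤
    f (Function.update (Function.update b i true) j false) +
      f (Function.update (Function.update b i false) j true)

/-- A random state does at least as well, in mean and for every submodular function, as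
independent coins with parameters `q`.  This is the form of negative dependence that all the
rounding steps preserve. -/
def DominatesCoins {N : ℕ} (μ : PMF (Fin N → Bool)) (q : Fin N → ℝ) : Prop :=
  ∀ f, IsPairwiseSubmodular f → multilinearExt f q ≤ expectation μ f

section rounding

variable {N : ℕ}

lemma coin_toReal {q : ℝ} (hq : q ∈ Set.Icc (0 : ℝ) 1) (c : Bool) :
    (coin q c).toReal = bernoulliWeight q c := by
  have h1 : ENNReal.ofReal q ≤ 1 := ENNReal.ofReal_le_one.2 hq.2
  cases c
  · simp only [coin, PMF.ofFintype_apply, bernoulliWeight, min_eq_left h1]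
    simp [ENNReal.toReal_sub_of_le h1, hq.1]
  · simp [coin, bernoulliWeight, min_eq_left h1, hq.1]

lemma expectation_independentCoins {q : Fin N → ℝ} (hq : ∀ i, q i ∈ Set.Icc (0 : ℝ) 1)
    (f : (Fin N → Bool) → ℝ) : expectation (independentCoins q) f = multilinearExt f q := by
  unfold expectation multilinearExt
  refine Finset.sum_congr rfl fun b _ => ?_
  rw [independentCoins, PMF.ofFintype_apply, ENNReal.toReal_prod]
  simp only [coin_toReal (hq _)]

lemma expectation_bind {α : Type*} [Fintype α] (μ : PMF α) (κ : α → PMF (Fin N → Bool))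
    (f : (Fin N → Bool) → ℝ) :
    expectation (μ.bind κ) f = ∑ x, (μ x).toReal * expectation (κ x) f := by
  have h : ∀ b, ((μ.bind κ) b).toReal = ∑ x, (μ x).toReal * (κ x b).toReal := by
    intro b
    rw [PMF.bind_apply, tsum_fintype, ENNReal.toReal_sum]
    · simp only [ENNReal.toReal_mul]
    · exact fun x _ => ENNReal.mul_ne_top (PMF.apply_ne_top _ _) (PMF.apply_ne_top _ _)
  simp only [expectation, h, Finset.sum_mul, Finset.mul_sum]
  rw [Finset.sum_comm]
  exact Finset.sum_congr rfl fun _ _ => Finset.sum_congr rfl fun _ _ => by ring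

lemma expectation_pure (b : Fin N → Bool) (f : (Fin N → Bool) → ℝ) :
    expectation (PMF.pure b) f = f b := by
  unfold expectation
  rw [Finset.sum_eq_single b]
  · simp
  · intro b' _ h
    simp [PMF.pure_apply, h]
  · simp

lemma expectation_const_mul (μ : PMF (Fin N → Bool)) (a : ℝ) (f : (Fin N → Bool) → ℝ) :
    expectation μ (fun b => a * f b) = a * expectation μ f := by
  simp only [expectation, Finset.mul_sum]
  exact Finset.sum_congr rfl fun b _ => by ring

lemma expectation_sum {ι : Type*} (μ : PMF (Fin N → Bool)) (s : Finset ι)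
    (f : ι → (Fin N → Bool) → ℝ) :
    expectation μ (fun b => ∑ i ∈ s, f i b) = ∑ i ∈ s, expectation μ (f i) := by
  simp only [expectation, Finset.mul_sum]
  rw [Finset.sum_comm]

lemma boolVec_mem_Icc (b : Fin N → Bool) (i : Fin N) : boolVec b i ∈ Set.Icc (0 : ℝ) 1 := by
  cases h : b i <;> simp [boolVec, h]

lemma multilinearExt_boolVec (f : (Fin N → Bool) → ℝ) (b : Fin N → Bool) :
    multilinearExt f (boolVec b) = f b := by
  unfold multilinearExt
  rw [Finset.sum_eq_single b]
  · have : ∏ i, bernoulliWeight (boolVec b i) (b i) = 1 :=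
      Finset.prod_eq_one fun i _ => by cases h : b i <;> simp [bernoulliWeight, boolVec, h]
    rw [this, one_mul]
  · intro b' _ h
    obtain ⟨i, hi⟩ := Function.ne_iff.1 h
    rw [Finset.prod_eq_zero (Finset.mem_univ i), zero_mul]
    cases h : b i <;> cases h' : b' i <;> simp_all [bernoulliWeight, boolVec]
  · simp

/-- A step of dependent rounding moves `q` along `± (e i - e j)` with zero mean, and the multilinear
extension of a submodular function is convex along this direction. -/
lemma multilinearExt_le_of_simplify {f : (Fin N → Bool) → ℝ} (hf : IsPairwiseSubmodular f)
    {q : Fin N → ℝ} (hq : ∀ i, q i ∈ Set.Icc (0 : ℝ) 1) {i j : Fin N} (hij : i ≠ j) {a b : ℝ}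
    (ha : 0 < a) (hb : 0 < b) :
    multilinearExt f q ≤
      b / (a + b) * multilinearExt f
        (Function.update (Function.update q i (q i + a)) j (q j - a)) +
      (1 - b / (a + b)) * multilinearExt f
        (Function.update (Function.update q i (q i - b)) j (q j + b)) := by
  have h0 : multilinearExt f q =
      multilinearExt f (Function.update (Function.update q i (q i)) j (q j)) := by simp
  rw [h0, multilinearExt_update_update, multilinearExt_update_update,
    multilinearExt_update_update, ← multilinearExt_const_mul, ← multilinearExt_const_mul,
    ← multilinearExt_add]
  refine multilinearExt_mono hq fun x => ?_
  have h := hf x i j hij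
  set f11 := f (Function.update (Function.update x i true) j true)
  set f10 := f (Function.update (Function.update x i true) j false)
  set f01 := f (Function.update (Function.update x i false) j true)
  set f00 := f (Function.update (Function.update x i false) j false)
  have hw : 1 - b / (a + b) = a / (a + b) := by field_simp; ring
  rw [hw, ← sub_nonneg]
  -- the variance of the step is `a * b`
  have key : a * b * (f10 + f01 - f11 - f00) =
      b / (a + b) * ((q i + a) * ((q j - a) * f11 + (1 - (q j - a)) * f10) +
          (1 - (q i + a)) * ((q j - a) * f01 + (1 - (q j - a)) * f00)) +
        a / (a + b) * ((q i - b) * ((q j + b) * f11 + (1 - (q j + b)) * f10) +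
          (1 - (q i - b)) * ((q j + b) * f01 + (1 - (q j + b)) * f00)) -
        (q i * (q j * f11 + (1 - q j) * f10) + (1 - q i) * (q j * f01 + (1 - q j) * f00)) := by
    field_simp
    ring
  rw [← key]
  exact mul_nonneg (mul_nonneg ha.le hb.le) (by linarith)

lemma IsDepRound.dominatesCoins {q : Fin N → ℝ} {μ : PMF (Fin N → Bool)} (h : IsDepRound q μ) :
    (∀ i, q i ∈ Set.Icc (0 : ℝ) 1) → DominatesCoins μ q := by
  induction h with
  | done b =>
    intro _ f _
    rw [expectation_pure, multilinearExt_boolVec]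
  | simplify y i j a b μ ν hij hi hj ha hb _ _ ihμ ihν =>
    intro hy f hf
    have ha0 : 0 < a := by rw [ha]; exact lt_min (by linarith [hi.2]) hj.1
    have hb0 : 0 < b := by rw [hb]; exact lt_min hi.1 (by linarith [hj.2])
    have ha1 : a ≤ 1 - y i := ha ▸ min_le_left _ _
    have ha2 : a ≤ y j := ha ▸ min_le_right _ _
    have hb1 : b ≤ y i := hb ▸ min_le_left _ _
    have hb2 : b ≤ 1 - y j := hb ▸ min_le_right _ _
    have hupd : ∀ s t : ℝ, s ∈ Set.Icc (0 : ℝ) 1 → t ∈ Set.Icc (0 : ℝ) 1 → ∀ l,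
        Function.update (Function.update y i s) j t l ∈ Set.Icc (0 : ℝ) 1 := by
      intro s t hs ht l
      by_cases hl : l = j
      · subst hl; simpa using ht
      · by_cases hl' : l = i
        · subst hl'; rw [Function.update_of_ne hl]; simpa using hs
        · rw [Function.update_of_ne hl, Function.update_of_ne hl']; exact hy l
    have hμ := ihμ (hupd _ _ ⟨by linarith [hi.1], by linarith⟩ ⟨by linarith, by linarith [hj.2]⟩)
      f hf
    have hν := ihν (hupd _ _ ⟨by linarith, by linarith [hi.2]⟩ ⟨by linarith [hj.1], by linarith⟩)
      f hf
    have hq : b / (a + b) ∈ Set.Icc (0 : ℝ) 1 :=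
      ⟨by positivity, (div_le_one (by positivity)).2 (by linarith)⟩
    rw [expectation_bind, Fintype.sum_bool, coin_toReal hq, coin_toReal hq]
    simp only [bernoulliWeight, if_true, Bool.false_eq_true, if_false]
    refine (multilinearExt_le_of_simplify hf hy hij ha0 hb0).trans ?_
    exact add_le_add (mul_le_mul_of_nonneg_left hμ hq.1)
      (mul_le_mul_of_nonneg_left hν (by linarith [hq.2]))

lemma coupledProb_mem_Icc {p p' : ℝ} (hp : p ∈ Set.Icc (0 : ℝ) 1) (hp' : p' ∈ Set.Icc (0 : ℝ) 1)
    (s : Bool) : coupledProb s p p' ∈ Set.Icc (0 : ℝ) 1 := by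
  obtain ⟨h0, h1⟩ := hp
  obtain ⟨h0', h1'⟩ := hp'
  unfold coupledProb
  split_ifs with h h'
  · exact ⟨div_nonneg (by linarith) h0, div_le_one_of_le₀ (by linarith [h.2]) h0⟩
  · exact ⟨div_nonneg h'.2.le (by linarith), div_le_one_of_le₀ (by linarith) (by linarith)⟩
  · simp
  · simp

lemma coupledProb_false_le_true {p p' : ℝ} (hp : p ∈ Set.Icc (0 : ℝ) 1)
    (hp' : p' ∈ Set.Icc (0 : ℝ) 1) : coupledProb false p p' ≤ coupledProb true p p' := by
  rcases lt_or_ge p p' with h | h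
  · have : coupledProb true p p' = 1 := by simp [coupledProb, h.le]
    rw [this]
    exact (coupledProb_mem_Icc hp hp' false).2
  · have : coupledProb false p p' = 0 := by simp [coupledProb, h]
    rw [this]
    exact (coupledProb_mem_Icc hp hp' true).1

lemma coupledProb_mean {p p' : ℝ} (hp' : p' ∈ Set.Icc (0 : ℝ) 1) :
    p * coupledProb true p p' + (1 - p) * coupledProb false p p' = p' := by
  rcases lt_trichotomy p p' with h | h | h
  · have h1 : (1 - p) ≠ 0 := by linarith [hp'.2]
    have h2 : ¬ p' - p < 0 := by linarith
    simp only [coupledProb, h2, sub_pos.2 h]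
    simp
    field_simp
    ring
  · subst h
    simp [coupledProb]
  · have h1 : p ≠ 0 := by linarith [hp'.1]
    have h2 : ¬ 0 < p' - p := by linarith
    simp only [coupledProb, h2, sub_neg.2 h]
    simp
    field_simp

/-- Re-randomizing every coordinate by a monotone kernel preserves submodularity. -/
lemma IsPairwiseSubmodular.comp_kernel {f : (Fin N → Bool) → ℝ} (hf : IsPairwiseSubmodular f)
    {p : Fin N → Bool → ℝ} (hp : ∀ i c, p i c ∈ Set.Icc (0 : ℝ) 1)
    (hmono : ∀ i, p i false ≤ p i true) :
    IsPairwiseSubmodular (fun x => multilinearExt f (fun i => p i (x i))) := by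
  intro x i j hij
  have hupd : ∀ c d : Bool,
      (fun l => p l (Function.update (Function.update x i c) j d l)) =
        Function.update (Function.update (fun l => p l (x l)) i (p i c)) j (p j d) := by
    intro c d
    ext l
    by_cases hl : l = j
    · subst hl; simp
    · by_cases hl' : l = i
      · subst hl'; simp [Function.update_of_ne hl]
      · simp [Function.update_of_ne hl, Function.update_of_ne hl']
  simp only [hupd, multilinearExt_update_update]
  rw [← multilinearExt_add, ← multilinearExt_add]
  refine multilinearExt_mono (fun l => hp l _) fun b => ?_
  have h := hf b i j hij
  have hd : 0 ≤ (p i true - p i false) * (p j true - p j false) :=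
    mul_nonneg (sub_nonneg.2 (hmono i)) (sub_nonneg.2 (hmono j))
  nlinarith [mul_nonneg hd (sub_nonneg.2 h)]

lemma DominatesCoins.coupledRounding {μ : PMF (Fin N → Bool)} {q q' : Fin N → ℝ}
    (h : DominatesCoins μ q) (hq : ∀ i, q i ∈ Set.Icc (0 : ℝ) 1)
    (hq' : ∀ i, q' i ∈ Set.Icc (0 : ℝ) 1) :
    DominatesCoins (μ.bind (fun x => coupledRounding x q q')) q' := by
  intro f hf
  have hp : ∀ i c, coupledProb c (q i) (q' i) ∈ Set.Icc (0 : ℝ) 1 :=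
    fun i c => coupledProb_mem_Icc (hq i) (hq' i) c
  have h1 := h _ (hf.comp_kernel hp fun i => coupledProb_false_le_true (hq i) (hq' i))
  rw [multilinearExt_comp f q (fun i c => coupledProb c (q i) (q' i))] at h1
  simp only [coupledProb_mean (hq' _)] at h1
  rw [expectation_bind]
  refine h1.trans_eq (Finset.sum_congr rfl fun x _ => ?_)
  rw [_root_.coupledRounding, expectation_independentCoins fun i => hp i (x i)]

lemma IsCoupledSample.dominatesCoins {Y : Set (Fin N → ℝ)}
    (hY : ∀ y ∈ Y, ∀ i, y i ∈ Set.Icc (0 : ℝ) 1) {q : Fin N → ℝ} {μ : PMF (Fin N → Bool)}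
    (h : IsCoupledSample Y q μ) : q ∈ Y ∧ DominatesCoins μ q := by
  induction h with
  | coins y hy => exact ⟨hy, fun f _ => (expectation_independentCoins (hY y hy) f).ge⟩
  | depRound y hy μ hμ => exact ⟨hy, hμ.dominatesCoins (hY y hy)⟩
  | step y y' hy' μ _ ih => exact ⟨hy', ih.2.coupledRounding (hY y ih.1) (hY y' hy')⟩

end rounding

/-! ### Truncated sums of Bernoulli variables -/

section truncated

variable {N : ℕ}

/-- Number of elements of `I` stored in `b`, truncated at `m`. -/
def truncatedCount (m : ℕ) (I : Finset (Fin N)) (b : Fin N → Bool) : ℝ :=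
  min (m : ℝ) (∑ o ∈ I, boolVec b o)

lemma sum_boolVec_eq_natCast (I : Finset (Fin N)) (b : Fin N → Bool) :
    ∑ o ∈ I, boolVec b o = ((I.filter fun o => b o = true).card : ℝ) := by
  simp [boolVec, Finset.sum_boole]

lemma boolVec_update (b : Fin N → Bool) (i : Fin N) (c : Bool) :
    boolVec (Function.update b i c) = Function.update (boolVec b) i (if c then 1 else 0) := by
  ext l
  by_cases h : l = i
  · subst h; simp [boolVec]
  · simp [boolVec, h]

lemma isPairwiseSubmodular_truncatedCount (m : ℕ) (I : Finset (Fin N)) :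
    IsPairwiseSubmodular (truncatedCount m I) := by
  intro b i j hij
  have hsum : ∀ c d : Bool,
      ∑ o ∈ I, boolVec (Function.update (Function.update b i c) j d) o =
        (if i ∈ I then (if c then 1 else 0) else 0) + (if j ∈ I then (if d then 1 else 0) else 0) +
          ∑ o ∈ (I.erase i).erase j, boolVec b o := by
    intro c d
    have h1 : ∀ o, boolVec (Function.update (Function.update b i c) j d) o =
        (if o = i then (if c then 1 else 0) else 0) + (if o = j then (if d then 1 else 0) else 0) +
          (if o ≠ j ∧ o ≠ i then boolVec b o else 0) := by
      intro o
      rw [boolVec_update, boolVec_update]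
      by_cases ho : o = j
      · subst ho; simp [hij.symm]
      · by_cases ho' : o = i
        · subst ho'; simp [ho]
        · simp [ho, ho']
    have h2 : (I.erase i).erase j = I.filter fun o => o ≠ j ∧ o ≠ i := by
      ext o; simp; tauto
    simp only [h1, Finset.sum_add_distrib]
    rw [h2, Finset.sum_filter]
    simp
  simp only [truncatedCount, hsum]
  set s := ∑ o ∈ (I.erase i).erase j, boolVec b o
  have hcc : ∀ u v : ℝ, 0 ≤ u → 0 ≤ v →
      min (m : ℝ) (u + v + s) + min (m : ℝ) s ≤ min (m : ℝ) (u + s) + min (m : ℝ) (v + s) := by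
    intro u v hu hv
    rcases min_cases (m : ℝ) (u + v + s) with h1 | h1 <;>
      rcases min_cases (m : ℝ) s with h2 | h2 <;>
      rcases min_cases (m : ℝ) (u + s) with h3 | h3 <;>
      rcases min_cases (m : ℝ) (v + s) with h4 | h4 <;> linarith
  have := hcc (if i ∈ I then 1 else 0) (if j ∈ I then 1 else 0) (by split_ifs <;> simp)
    (by split_ifs <;> simp)
  simpa using this

/-- Adding one more independent coin closes a fraction `q l / m` of the gap to `m`: it increases
the truncated count whenever this is below `m`, which has probability at least
`1 - 𝔼[truncated count] / m`. -/
lemma multilinearExt_truncatedCount_insert {m : ℕ} (hm : 1 ≤ m) {q : Fin N → ℝ}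
    (hq : ∀ i, q i ∈ Set.Icc (0 : ℝ) 1) {I : Finset (Fin N)} {l : Fin N} (hl : l ∉ I) :
    (m : ℝ) - multilinearExt (truncatedCount m (insert l I)) q ≤
      (m - multilinearExt (truncatedCount m I) q) * (1 - q l / m) := by
  have hm0 : (0 : ℝ) < m := by exact_mod_cast hm
  suffices h : q l + (1 - q l / m) * multilinearExt (truncatedCount m I) q ≤
      multilinearExt (truncatedCount m (insert l I)) q by
    have : (m : ℝ) * (q l / m) = q l := by field_simp
    nlinarith
  have h0 : multilinearExt (truncatedCount m (insert l I)) q =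
      multilinearExt (truncatedCount m (insert l I)) (Function.update q l (q l)) := by simp
  rw [h0, multilinearExt_update, ← multilinearExt_const_mul,
    ← multilinearExt_const (q l) q, ← multilinearExt_add, multilinearExt_const]
  refine multilinearExt_mono hq fun b => ?_
  have hsum : ∀ c : Bool, ∑ o ∈ insert l I, boolVec (Function.update b l c) o =
      (if c then 1 else 0) + ((I.filter fun o => b o = true).card : ℝ) := by
    intro c
    rw [Finset.sum_insert hl, boolVec_update, ← sum_boolVec_eq_natCast]
    congr 1
    · simp
    · refine Finset.sum_congr rfl fun o ho => ?_
      rw [Function.update_of_ne (ne_of_mem_of_not_mem ho hl)]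
  simp only [truncatedCount, hsum]
  rw [sum_boolVec_eq_natCast]
  set s := (I.filter fun o => b o = true).card
  have hql := hq l
  rcases lt_or_ge s m with h | h
  · have h1 : (1 : ℝ) + s ≤ m := by exact_mod_cast (by omega : 1 + s ≤ m)
    have h2 : (s : ℝ) ≤ m := by linarith
    simp [min_eq_right h1, min_eq_right h2]
    have : 0 ≤ q l / m * s := mul_nonneg (div_nonneg hql.1 hm0.le) (Nat.cast_nonneg _)
    nlinarith
  · have h2 : (m : ℝ) ≤ s := by exact_mod_cast h
    have h1 : (m : ℝ) ≤ 1 + s := by linarith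
    simp [min_eq_left h1, min_eq_left h2]
    apply le_of_eq
    field_simp
    ring

lemma multilinearExt_truncatedCount_ge {m : ℕ} (hm : 1 ≤ m) {q : Fin N → ℝ}
    (hq : ∀ i, q i ∈ Set.Icc (0 : ℝ) 1) (I : Finset (Fin N)) :
    (m : ℝ) - multilinearExt (truncatedCount m I) q ≤ m * Real.exp (-(∑ o ∈ I, q o) / m) := by
  have hm1 : (1 : ℝ) ≤ m := by exact_mod_cast hm
  have hm0 : (0 : ℝ) < m := by linarith
  induction I using Finset.induction_on with
  | empty =>
    have : truncatedCount m (∅ : Finset (Fin N)) = fun _ => 0 := by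
      ext b; simp [truncatedCount]
    rw [this, multilinearExt_const]
    simp
  | insert l I hl ih =>
    have h1 : 0 ≤ 1 - q l / m := by
      rw [sub_nonneg, div_le_one hm0]
      exact (hq l).2.trans hm1
    have h2 : 1 - q l / m ≤ Real.exp (-(q l / m)) := by
      linarith [Real.add_one_le_exp (-(q l / m))]
    calc _ ≤ (m - multilinearExt (truncatedCount m I) q) * (1 - q l / m) :=
          multilinearExt_truncatedCount_insert hm hq hl
      _ ≤ (m * Real.exp (-(∑ o ∈ I, q o) / m)) * Real.exp (-(q l / m)) :=
          mul_le_mul ih h2 h1 (by positivity)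
      _ = _ := by
          rw [mul_assoc, ← Real.exp_add, Finset.sum_insert hl]
          congr 2
          ring

lemma one_sub_exp_neg_ge {u : ℝ} (hu : 0 ≤ u) :
    (1 - 1 / Real.exp 1) * min 1 u ≤ 1 - Real.exp (-u) := by
  rw [one_div, ← Real.exp_neg]
  rcases le_total 1 u with h | h
  · rw [min_eq_left h]
    have := Real.exp_le_exp.2 (neg_le_neg h)
    linarith
  · rw [min_eq_right h]
    -- convexity of `exp` on the segment from `0` to `-1`
    have := convexOn_exp.2 (Set.mem_univ (0 : ℝ)) (Set.mem_univ (-1 : ℝ)) (sub_nonneg.2 h) hu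
      (by ring)
    simp at this
    linarith

/-- The correlation gap of truncated counts: independent coins lose at most a factor `1 - 1 / e`
with respect to the concave function `q ↦ min m (∑ q)`. -/
lemma multilinearExt_truncatedCount_correlation_gap {m : ℕ} (hm : 1 ≤ m) {q : Fin N → ℝ}
    (hq : ∀ i, q i ∈ Set.Icc (0 : ℝ) 1) (I : Finset (Fin N)) :
    (1 - 1 / Real.exp 1) * min (m : ℝ) (∑ o ∈ I, q o) ≤
      multilinearExt (truncatedCount m I) q := by
  have hm0 : (0 : ℝ) < m := by exact_mod_cast hm
  have hu : 0 ≤ (∑ o ∈ I, q o) / m := div_nonneg (Finset.sum_nonneg fun i _ => (hq i).1) hm0.le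
  have h1 := mul_le_mul_of_nonneg_left (one_sub_exp_neg_ge hu) hm0.le
  have h2 := multilinearExt_truncatedCount_ge hm hq I
  have h3 : min (m : ℝ) (∑ o ∈ I, q o) = m * min 1 ((∑ o ∈ I, q o) / m) := by
    rw [mul_min_of_nonneg _ _ hm0.le, mul_one, mul_div_cancel₀ _ hm0.ne']
  rw [h3]
  rw [← neg_div] at h1
  linarith

end truncated

/-! ### The concave extension of the caching gain -/

namespace SimilarityCache

variable {R : Type*} {N : ℕ} (S : SimilarityCache R N)

/-- The `i` elements of the augmented catalog that are closest to `r`. -/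
def closest (r : R) (i : ℕ) : Finset (Fin N ⊕ Fin N) := (Finset.Icc 1 i).image (S.ord r)

/-- The objects whose local copy, but not the server copy, is among the `i` elements closest to
`r`.  Only the presence of these objects in the cache matters for the number of available elements
among the `i` closest ones. -/
def pivotal (r : R) (i : ℕ) : Finset (Fin N) :=
  Finset.univ.filter fun o => Sum.inl o ∈ S.closest r i ∧ Sum.inr o ∉ S.closest r i

lemma ord_injOn (r : R) {i : ℕ} (hi : i ≤ 2 * N) : Set.InjOn (S.ord r) (Finset.Icc 1 i) := by
  refine (S.ord_bijOn r).injOn.mono ?_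
  rw [Finset.coe_Icc]
  exact Set.Icc_subset_Icc_right hi

lemma sum_closest (r : R) {i : ℕ} (hi : i ≤ 2 * N) (φ : Fin N ⊕ Fin N → ℝ) :
    ∑ j ∈ Finset.Icc 1 i, φ (S.ord r j) = ∑ u ∈ S.closest r i, φ u := by
  rw [closest, Finset.sum_image (S.ord_injOn r hi)]

/-- The server copy of an object costs `cf` more than its local copy, hence comes later. -/
lemma inl_mem_closest_of_inr_mem {r : R} {i : ℕ} (hi : i ≤ 2 * N) {o : Fin N}
    (h : Sum.inr o ∈ S.closest r i) : Sum.inl o ∈ S.closest r i := by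
  simp only [closest, Finset.mem_image, Finset.mem_Icc] at h ⊢
  obtain ⟨j, ⟨hj1, hj⟩, hjo⟩ := h
  obtain ⟨j', hj', hjo'⟩ := (S.ord_bijOn r).surjOn (Set.mem_univ (Sum.inl o))
  refine ⟨j', ⟨hj'.1, ?_⟩, hjo'⟩
  by_contra hlt
  have := S.ord_monotoneOn r (Set.mem_Icc.2 ⟨hj1, hj.trans hi⟩) hj' (by omega)
  simp only [hjo, hjo', Sum.elim_inl, Sum.elim_inr] at this
  linarith [S.cf_pos]

lemma sigma_eq (r : R) {i : ℕ} (hi : i ≤ 2 * N) :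
    (S.sigma r i : ℝ) = ∑ o, if Sum.inr o ∈ S.closest r i then (1 : ℝ) else 0 := by
  have h := S.sum_closest r hi (Sum.elim (fun _ => 0) (fun _ => 1))
  have h1 : (S.sigma r i : ℝ) =
      ∑ j ∈ Finset.Icc 1 i, (Sum.elim (fun _ => 0) (fun _ => 1) (S.ord r j) : ℝ) := by
    rw [sigma, ← Finset.sum_boole]
    refine Finset.sum_congr rfl fun j _ => ?_
    cases S.ord r j <;> simp
  rw [h1, h, ← Finset.univ_inter (S.closest r i), ← Finset.sum_ite_mem, Fintype.sum_sum_type]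
  simp

lemma sum_augment_sub_sigma (r : R) {i : ℕ} (hi : i ≤ 2 * N) (y : Fin N → ℝ) :
    ∑ j ∈ Finset.Icc 1 i, augment y (S.ord r j) - S.sigma r i = ∑ o ∈ S.pivotal r i, y o := by
  rw [S.sum_closest r hi, S.sigma_eq r hi, ← Finset.univ_inter (S.closest r i),
    ← Finset.sum_ite_mem, Fintype.sum_sum_type, ← Finset.sum_add_distrib,
    ← Finset.sum_sub_distrib, pivotal, Finset.sum_filter]
  refine Finset.sum_congr rfl fun o _ => ?_
  simp only [Finset.univ_inter]
  by_cases h : Sum.inr o ∈ S.closest r i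
  · simp [h, S.inl_mem_closest_of_inr_mem hi h, augment]
  · by_cases h' : Sum.inl o ∈ S.closest r i <;> simp [h, h', augment]

lemma sigma_succ_le (r : R) (i : ℕ) : S.sigma r (i + 1) ≤ S.sigma r i + 1 := by
  rw [sigma, sigma, ← Finset.insert_Icc_right_eq_Icc_add_one (by omega : 1 ≤ i + 1),
    Finset.filter_insert]
  split_ifs
  · exact Finset.card_insert_le _ _
  · omega

lemma sigma_mono (r : R) : Monotone (S.sigma r) := fun _ _ h =>
  Finset.card_le_card (Finset.filter_subset_filter _ (Finset.Icc_subset_Icc_right h))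

lemma closest_full (r : R) : S.closest r (2 * N) = Finset.univ := by
  ext u
  obtain ⟨j, hj, hju⟩ := (S.ord_bijOn r).surjOn (Set.mem_univ u)
  simp only [closest, Finset.mem_image, Finset.mem_Icc, Finset.mem_univ, iff_true]
  exact ⟨j, hj, hju⟩

lemma sigma_full (r : R) : S.sigma r (2 * N) = N := by
  have h := S.sigma_eq r le_rfl
  rw [closest_full] at h
  simp at h
  exact_mod_cast h

/-- Server copies appear one at a time, so the count `sigma` does take the value `k`. -/
lemma lastIdx_spec (r : R) :
    S.lastIdx r ∈ Set.Icc 1 (2 * N) ∧ S.sigma r (S.lastIdx r) = S.k := by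
  have hex : ∃ i, S.k ≤ S.sigma r i := ⟨2 * N, by rw [sigma_full]; exact S.k_le⟩
  classical
  have hne : {i | i ∈ Set.Icc 1 (2 * N) ∧ S.sigma r i = S.k}.Nonempty := by
    have hk := S.one_le_k
    have h0 : S.sigma r 0 = 0 := by simp [sigma]
    have hspec := Nat.find_spec hex
    obtain ⟨i, hi⟩ : ∃ i, Nat.find hex = i + 1 := by
      refine Nat.exists_eq_succ_of_ne_zero fun h => ?_
      rw [h, h0] at hspec
      omega
    have hlt := Nat.find_min hex (show i < Nat.find hex by omega)
    have hs := S.sigma_succ_le r i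
    have hle : Nat.find hex ≤ 2 * N := Nat.find_min' hex (by rw [sigma_full]; exact S.k_le)
    rw [hi] at hspec hle
    exact ⟨i + 1, ⟨by omega, hle⟩, by omega⟩
  exact Nat.sInf_mem hne

lemma sigma_lt_of_lt_lastIdx (r : R) {i : ℕ} (hi : i < S.lastIdx r) :
    S.sigma r i < S.k := by
  obtain ⟨h1, h2⟩ := S.lastIdx_spec r
  refine lt_of_le_of_ne ((S.sigma_mono r hi.le).trans_eq h2) fun h => ?_
  rcases Nat.eq_zero_or_pos i with rfl | h0
  · have h00 : S.sigma r 0 = 0 := by simp [sigma]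
    have := S.one_le_k
    omega
  · exact Nat.notMem_of_lt_sInf hi ⟨⟨h0, hi.le.trans h1.2⟩, h⟩

lemma alpha_nonneg (r : R) {i : ℕ} (hi : i ∈ Finset.Ico 1 (S.lastIdx r)) : 0 ≤ S.alpha r i := by
  have h := (S.lastIdx_spec r).1.2
  rw [Finset.mem_Ico] at hi
  exact sub_nonneg.2 (S.ord_monotoneOn r (Set.mem_Icc.2 ⟨hi.1, by omega⟩)
    (Set.mem_Icc.2 ⟨by omega, by omega⟩) (by omega))

/-- The concave extension is a nonnegative combination of truncated sums. -/
lemma fracGain_eq (r : R) (y : Fin N → ℝ) :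
    S.fracGain r y = ∑ i ∈ Finset.Ico 1 (S.lastIdx r), S.alpha r i *
      min ((S.k - S.sigma r i : ℕ) : ℝ) (∑ o ∈ S.pivotal r i, y o) := by
  refine Finset.sum_congr rfl fun i hi => ?_
  rw [Finset.mem_Ico] at hi
  rw [S.sum_augment_sub_sigma r (hi.2.le.trans (S.lastIdx_spec r).1.2),
    Nat.cast_sub (S.sigma_lt_of_lt_lastIdx r hi.2).le]

/-! ### The gain of integral states -/

/-- The cost of a service is, by summation by parts, governed by the number of available elements
among the `i` closest ones, truncated at `k`. -/
lemma serviceCost_eq (r : R) {x : Fin N ⊕ Fin N → ℝ} (hx : ∀ u, x u = 0 ∨ x u = 1) :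
    S.serviceCost r x = S.cost r (S.ord r (2 * N)) *
        min (S.k : ℝ) (∑ j ∈ Finset.Icc 1 (2 * N), x (S.ord r j)) -
      ∑ i ∈ Finset.Ico 1 (2 * N), S.alpha r i *
        min (S.k : ℝ) (∑ j ∈ Finset.Icc 1 i, x (S.ord r j)) := by
  have hN : 1 ≤ N := S.one_le_h.trans S.h_le
  -- integrality: partial sums increase by steps of `0` or `1`, and cannot jump over `k`
  have hnat : ∀ i, ∃ n : ℕ, ∑ j ∈ Finset.Ico 1 i, x (S.ord r j) = n := by
    intro i
    refine ⟨((Finset.Ico 1 i).filter fun j => x (S.ord r j) = 1).card, ?_⟩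
    rw [← Finset.sum_boole]
    refine Finset.sum_congr rfl fun j _ => ?_
    rcases hx (S.ord r j) with h | h <;> simp [h]
  have hstep : ∀ i, 1 ≤ i → x (S.ord r i) *
      (if ∑ j ∈ Finset.Ico 1 i, x (S.ord r j) < (S.k : ℝ) then 1 else 0) =
      min (S.k : ℝ) (∑ j ∈ Finset.Icc 1 i, x (S.ord r j)) -
        min (S.k : ℝ) (∑ j ∈ Finset.Ico 1 i, x (S.ord r j)) := by
    intro i hi
    obtain ⟨n, hn⟩ := hnat i
    rw [← Finset.Ico_insert_right hi, Finset.sum_insert (by simp), hn]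
    rcases lt_or_ge n S.k with h | h
    · have h1 : (n : ℝ) + 1 ≤ S.k := by exact_mod_cast h
      have h2 : (n : ℝ) < S.k := by linarith
      rw [if_pos h2, min_eq_right h2.le, min_eq_right]
      · ring
      · rcases hx (S.ord r i) with h | h <;> rw [h] <;> linarith
    · have h1 : (S.k : ℝ) ≤ n := by exact_mod_cast h
      rw [if_neg h1.not_gt, min_eq_left h1, min_eq_left]
      · ring
      · rcases hx (S.ord r i) with h | h <;> rw [h] <;> linarith
  have hparts : ∀ M, 1 ≤ M → ∑ i ∈ Finset.Icc 1 M, S.cost r (S.ord r i) * x (S.ord r i) *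
      (if ∑ j ∈ Finset.Ico 1 i, x (S.ord r j) < (S.k : ℝ) then 1 else 0) =
      S.cost r (S.ord r M) * min (S.k : ℝ) (∑ j ∈ Finset.Icc 1 M, x (S.ord r j)) -
      ∑ i ∈ Finset.Ico 1 M, S.alpha r i *
        min (S.k : ℝ) (∑ j ∈ Finset.Icc 1 i, x (S.ord r j)) := by
    intro M hM
    induction M, hM using Nat.le_induction with
    | base =>
      have := hstep 1 le_rfl
      simp only [Finset.Icc_self, Finset.sum_singleton, Finset.Ico_self, Finset.sum_empty,
        sub_zero] at this ⊢
      rw [mul_assoc, this]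
      simp
    | succ M hM ih =>
      have h := hstep (M + 1) (by omega)
      rw [Finset.sum_Icc_succ_top (by omega), ih, mul_assoc, h, Finset.sum_Ico_succ_top hM
        (fun i => S.alpha r i * _), Finset.Ico_add_one_right_eq_Icc,
        show S.alpha r M = S.cost r (S.ord r (M + 1)) - S.cost r (S.ord r M) from rfl]
      ring
  exact hparts (2 * N) (by omega)

/-- The function `fracGain` extends the caching gain of integral states. -/
lemma gain_eq_fracGain (r : R) (b : Fin N → Bool) : S.gain r b = S.fracGain r (boolVec b) := by
  have haug : ∀ u, augment (boolVec b) u = 0 ∨ augment (boolVec b) u = 1 := by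
    rintro (o | o) <;> cases h : b o <;> simp [augment, boolVec, h]
  have haug0 : ∀ u, augment (fun _ : Fin N => (0 : ℝ)) u = 0 ∨
      augment (fun _ : Fin N => (0 : ℝ)) u = 1 := by
    rintro (o | o) <;> simp [augment]
  have hsum : ∀ (y : Fin N → ℝ) {i : ℕ}, i ≤ 2 * N →
      ∑ j ∈ Finset.Icc 1 i, augment y (S.ord r j) = S.sigma r i + ∑ o ∈ S.pivotal r i, y o := by
    intro y i hi
    linarith [S.sum_augment_sub_sigma r hi y]
  have hpos : ∀ i, 0 ≤ ∑ o ∈ S.pivotal r i, boolVec b o :=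
    fun i => Finset.sum_nonneg fun o _ => (boolVec_mem_Icc b o).1
  obtain ⟨⟨hK1, hK2⟩, hK⟩ := S.lastIdx_spec r
  -- from the index `lastIdx` on, enough server copies are available in both states
  have hlate : ∀ i, S.lastIdx r ≤ i → ∀ s : ℝ, 0 ≤ s → min (S.k : ℝ) (S.sigma r i + s) = S.k := by
    intro i hi s hs
    have : (S.k : ℝ) ≤ S.sigma r i := by exact_mod_cast hK ▸ S.sigma_mono r hi
    exact min_eq_left (by linarith)
  have hlast : ∀ s : ℝ, 0 ≤ s → min (S.k : ℝ) (S.sigma r (2 * N) + s) = S.k := hlate _ hK2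
  rw [gain, S.serviceCost_eq r haug, S.serviceCost_eq r haug0, hsum _ le_rfl, hsum _ le_rfl,
    hlast _ (hpos _), hlast _ (by simp), sub_sub_sub_cancel_left, ← Finset.sum_sub_distrib,
    S.fracGain_eq, ← Finset.sum_Ico_consecutive _ hK1 hK2]
  rw [Finset.sum_eq_zero (s := Finset.Ico (S.lastIdx r) (2 * N)), add_zero]
  · refine Finset.sum_congr rfl fun i hi => ?_
    rw [Finset.mem_Ico] at hi
    have hlt := S.sigma_lt_of_lt_lastIdx r hi.2
    have hle : (S.sigma r i : ℝ) ≤ S.k := by exact_mod_cast hlt.le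
    rw [hsum _ (hi.2.le.trans hK2), hsum _ (hi.2.le.trans hK2), Nat.cast_sub hlt.le,
      Finset.sum_const_zero, add_zero, min_eq_right hle, ← mul_sub, ← min_sub_sub_right,
      add_sub_cancel_left]
  · intro i hi
    rw [Finset.mem_Ico] at hi
    rw [hsum _ hi.2.le, hsum _ hi.2.le, hlate i hi.1 _ (hpos i), hlate i hi.1 _ (by simp), sub_self]

lemma avgGain_eq_avgFracGain {T : ℕ} (r : Fin T → R) (b : Fin N → Bool) :
    S.avgGain r b = S.avgFracGain r (boolVec b) := by
  simp only [avgGain, avgFracGain, gain_eq_fracGain]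

lemma avgFracGain_nonneg {T : ℕ} (r : Fin T → R) {y : Fin N → ℝ} (hy : ∀ i, 0 ≤ y i) :
    0 ≤ S.avgFracGain r y := by
  refine mul_nonneg (by positivity) (Finset.sum_nonneg fun t _ => ?_)
  rw [fracGain_eq]
  exact Finset.sum_nonneg fun i hi => mul_nonneg (S.alpha_nonneg _ hi)
    (le_min (Nat.cast_nonneg _) (Finset.sum_nonneg fun o _ => hy o))

lemma concaveOn_avgFracGain {T : ℕ} (r : Fin T → R) :
    ConcaveOn ℝ Set.univ (S.avgFracGain r) := by
  have hmin : ∀ (m : ℝ) (I : Finset (Fin N)),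
      ConcaveOn ℝ Set.univ (fun y : Fin N → ℝ => min m (∑ o ∈ I, y o)) := by
    intro m I
    refine (concaveOn_const m convex_univ).inf ?_
    exact ⟨convex_univ, fun y _ y' _ a a' _ _ _ => by
      simp [Finset.sum_add_distrib, Finset.mul_sum]⟩
  refine ⟨convex_univ, fun y _ y' _ a a' ha ha' haa => ?_⟩
  simp only [avgFracGain, fracGain_eq, smul_eq_mul, Finset.mul_sum, ← Finset.sum_add_distrib]
  refine Finset.sum_le_sum fun t _ => Finset.sum_le_sum fun i hi => ?_
  have h := (hmin ((S.k - S.sigma (r t) i : ℕ) : ℝ) (S.pivotal (r t) i)).2 (Set.mem_univ y)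
    (Set.mem_univ y') ha ha' haa
  have h0 : 0 ≤ 1 / (T : ℝ) * S.alpha (r t) i :=
    mul_nonneg (by positivity) (S.alpha_nonneg _ hi)
  have := mul_le_mul_of_nonneg_left h h0
  simp only [smul_eq_mul] at this
  linarith

lemma exists_lipschitz_avgFracGain {T : ℕ} (r : Fin T → R) :
    ∃ L : ℝ, ∀ y y', S.avgFracGain r y - S.avgFracGain r y' ≤ L * ∑ o, |y o - y' o| := by
  have hmin : ∀ m a b : ℝ, min m a - min m b ≤ |a - b| := fun m a b =>
    (le_abs_self _).trans ((abs_min_sub_min_le_max m a m b).trans (by simp))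
  refine ⟨∑ t, ∑ i ∈ Finset.Ico 1 (S.lastIdx (r t)), 1 / (T : ℝ) * S.alpha (r t) i,
    fun y y' => ?_⟩
  simp only [avgFracGain, fracGain_eq]
  rw [← mul_sub, ← Finset.sum_sub_distrib, Finset.mul_sum, Finset.sum_mul]
  refine Finset.sum_le_sum fun t _ => ?_
  rw [← Finset.sum_sub_distrib, Finset.mul_sum, Finset.sum_mul]
  refine Finset.sum_le_sum fun i hi => ?_
  rw [← mul_sub, ← mul_assoc]
  refine mul_le_mul_of_nonneg_left ?_ (mul_nonneg (by positivity) (S.alpha_nonneg _ hi))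
  calc _ ≤ |∑ o ∈ S.pivotal (r t) i, y o - ∑ o ∈ S.pivotal (r t) i, y' o| := hmin _ _ _
    _ ≤ ∑ o ∈ S.pivotal (r t) i, |y o - y' o| := by
        rw [← Finset.sum_sub_distrib]
        exact Finset.abs_sum_le_sum_abs _ _
    _ ≤ _ := Finset.sum_le_sum_of_subset_of_nonneg (Finset.subset_univ _)
        fun o _ _ => abs_nonneg _

/-- A state that is negatively dependent with means `q` obtains a fraction `1 - 1 / e` of the
concave extension at `q`. -/
lemma expectation_avgGain_ge {T : ℕ} (r : Fin T → R) {q : Fin N → ℝ}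
    (hq : ∀ i, q i ∈ Set.Icc (0 : ℝ) 1) {μ : PMF (Fin N → Bool)} (hμ : DominatesCoins μ q) :
    (1 - 1 / Real.exp 1) * S.avgFracGain r q ≤ expectation μ (S.avgGain r) := by
  have h : expectation μ (S.avgGain r) = 1 / (T : ℝ) * ∑ t,
      ∑ i ∈ Finset.Ico 1 (S.lastIdx (r t)), S.alpha (r t) i *
        expectation μ (truncatedCount (S.k - S.sigma (r t) i) (S.pivotal (r t) i)) := by
    rw [show S.avgGain r = fun b => 1 / (T : ℝ) * ∑ t,
      ∑ i ∈ Finset.Ico 1 (S.lastIdx (r t)), S.alpha (r t) i *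
        truncatedCount (S.k - S.sigma (r t) i) (S.pivotal (r t) i) b from ?_]
    · simp only [expectation_const_mul, expectation_sum]
    · ext b
      simp only [avgGain_eq_avgFracGain, avgFracGain, fracGain_eq, truncatedCount]
  rw [h, avgFracGain, mul_left_comm]
  refine mul_le_mul_of_nonneg_left ?_ (by positivity)
  rw [Finset.mul_sum]
  refine Finset.sum_le_sum fun t _ => ?_
  rw [fracGain_eq, Finset.mul_sum]
  refine Finset.sum_le_sum fun i hi => ?_
  rw [mul_left_comm]
  refine mul_le_mul_of_nonneg_left ?_ (S.alpha_nonneg _ hi)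
  have hm : 1 ≤ S.k - S.sigma (r t) i := by
    have := S.sigma_lt_of_lt_lastIdx (r t) (Finset.mem_Ico.1 hi).2
    omega
  exact (multilinearExt_truncatedCount_correlation_gap hm hq _).trans
    (hμ _ (isPairwiseSubmodular_truncatedCount _ _))

end SimilarityCache

/-! ### The entropic Bregman divergence -/

section entropy

variable {N : ℕ}

lemma hasFDerivAt_negEntropy {v : Fin N → ℝ} (hv : v ∈ posOrthant N) :
    HasFDerivAt negEntropy
      (∑ i, (Real.log (v i) + 1) • ContinuousLinearMap.proj (R := ℝ) (φ := fun _ => ℝ) i) v := by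
  have h : ∀ i, HasFDerivAt (fun y : Fin N → ℝ => y i * Real.log (y i))
      ((Real.log (v i) + 1) • ContinuousLinearMap.proj (R := ℝ) (φ := fun _ => ℝ) i) v := fun i =>
    HasDerivAt.comp_hasFDerivAt (h₂ := fun t => t * Real.log t) v
      (Real.hasDerivAt_mul_log (hv i).ne')
      (ContinuousLinearMap.proj (R := ℝ) (φ := fun _ : Fin N => ℝ) i).hasFDerivAt
  exact HasFDerivAt.fun_sum fun i _ => h i

lemma bregman_negEntropy {v : Fin N → ℝ} (hv : v ∈ posOrthant N) (u : Fin N → ℝ) :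
    bregman negEntropy u v = ∑ i, (u i * Real.log (u i) - v i * Real.log (v i) -
      (Real.log (v i) + 1) * (u i - v i)) := by
  rw [bregman, (hasFDerivAt_negEntropy hv).fderiv]
  simp [negEntropy, Finset.sum_sub_distrib]

lemma mul_log_bregman_ge {u v : ℝ} (hu : u ∈ Set.Icc (0 : ℝ) 1) (hv : 0 < v) (hv1 : v ≤ 1) :
    (u - v) ^ 2 / 4 ≤ u * Real.log u - v * Real.log v - (Real.log v + 1) * (u - v) := by
  rcases hu.1.eq_or_lt with rfl | hu0
  · simp
    nlinarith
  -- with `a = √u` and `b = √v`, the right-hand side is at least `(a - b) ^ 2`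
  have ha : 0 < √u := Real.sqrt_pos.2 hu0
  have hb : 0 < √v := Real.sqrt_pos.2 hv
  have ha1 : √u ≤ 1 := Real.sqrt_le_one.2 hu.2
  have hb1 : √v ≤ 1 := Real.sqrt_le_one.2 hv1
  have hua : u = √u ^ 2 := (Real.sq_sqrt hu0.le).symm
  have hvb : v = √v ^ 2 := (Real.sq_sqrt hv.le).symm
  generalize √u = a at *
  generalize √v = b at *
  subst hua hvb
  have hlog := Real.log_le_sub_one_of_pos (div_pos hb ha)
  rw [Real.log_div hb.ne' ha.ne'] at hlog
  have h1 := mul_le_mul_of_nonneg_left hlog (sq_nonneg a)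
  have h2 : a ^ 2 * (b / a - 1) = a * b - a ^ 2 := by field_simp
  rw [h2] at h1
  rw [Real.log_pow, Real.log_pow]
  push_cast
  have h3 : (a ^ 2 - b ^ 2) ^ 2 / 4 ≤ (a - b) ^ 2 := by
    have : (a + b) ^ 2 ≤ 4 := by nlinarith
    nlinarith [mul_le_mul_of_nonneg_left this (sq_nonneg (a - b))]
  nlinarith

lemma mul_log_bregman_nonneg {u v : ℝ} (hu : 0 ≤ u) (hv : 0 < v) :
    0 ≤ u * Real.log u - v * Real.log v - (Real.log v + 1) * (u - v) := by
  rcases hu.eq_or_lt with rfl | hu0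
  · simp
    nlinarith
  have hlog := Real.log_le_sub_one_of_pos (div_pos hv hu0)
  rw [Real.log_div hv.ne' hu0.ne'] at hlog
  have h1 := mul_le_mul_of_nonneg_left hlog hu
  have h2 : u * (v / u - 1) = v - u := by field_simp
  rw [h2] at h1
  nlinarith

lemma bregman_negEntropy_nonneg {u v : Fin N → ℝ} (hu : ∀ i, 0 ≤ u i) (hv : v ∈ posOrthant N) :
    0 ≤ bregman negEntropy u v := by
  rw [bregman_negEntropy hv]
  exact Finset.sum_nonneg fun i _ => mul_log_bregman_nonneg (hu i) (hv i)

end entropy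

/-! ### Regret of entropic mirror ascent -/

section mirror

variable {N : ℕ}

/-- First-order optimality on `Y ∩ posOrthant N`, tested against any point of `Y`, including those
on the boundary of the orthant. -/
lemma IsMinOn.fderiv_sub_nonneg {Φ : (Fin N → ℝ) → ℝ} {Φ' : (Fin N → ℝ) →L[ℝ] ℝ}
    {Y : Set (Fin N → ℝ)} (hY : Convex ℝ Y) {y u : Fin N → ℝ} (hy : y ∈ Y ∩ posOrthant N)
    (hmin : IsMinOn Φ (Y ∩ posOrthant N) y) (hΦ : HasFDerivAt Φ Φ' y) (hu : u ∈ Y)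
    (hu0 : ∀ i, 0 ≤ u i) : 0 ≤ Φ' (u - y) := by
  refine hmin.localize.hasFDerivWithinAt_nonneg hΦ.hasFDerivWithinAt
    (sub_mem_posTangentConeAt_of_openSegment_subset fun w hw => ?_)
  refine ⟨hY.openSegment_subset hy.1 hu hw, fun i => ?_⟩
  obtain ⟨a, b, ha, hb, -, rfl⟩ := hw
  have h1 := mul_pos ha (hy.2 i)
  have h2 := mul_nonneg hb.le (hu0 i)
  simp only [Pi.add_apply, Pi.smul_apply, smul_eq_mul]
  linarith

/-- A supergradient of an `ℓ¹`-Lipschitz function has coordinates bounded by the Lipschitz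
constant. -/
lemma IsConcaveSubgradient.abs_le {F : (Fin N → ℝ) → ℝ} {L : ℝ}
    (hF : ∀ y y', F y - F y' ≤ L * ∑ o, |y o - y' o|) {y g : Fin N → ℝ}
    (hg : IsConcaveSubgradient F y g) (i : Fin N) : |g i| ≤ L := by
  have h : ∀ s : ℝ, |s| = 1 → -(g i * s) ≤ L := by
    intro s hs
    have h1 := hg (Function.update y i (y i + s))
    have h2 := hF y (Function.update y i (y i + s))
    rw [Finset.sum_eq_single i (fun j _ hj => by simp [hj]) (by simp)] at h1 h2
    simp [hs] at h1 h2
    linarith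
  exact _root_.abs_le.2 ⟨by linarith [h 1 (by simp)], by linarith [h (-1) (by simp)]⟩

/-- One step of mirror ascent: the gain of the linearized objective is controlled by the decrease of
the divergence to the comparator `u`, up to a term of second order in the learning rate. -/
lemma mirror_step {Y : Set (Fin N → ℝ)} (hY : Convex ℝ Y)
    (hY1 : ∀ y ∈ Y, ∀ i, y i ∈ Set.Icc (0 : ℝ) 1) {η L : ℝ}
    {y z y' g u : Fin N → ℝ} (hg : ∀ i, |g i| ≤ L)
    (hy : y ∈ Y ∩ posOrthant N) (hy' : y' ∈ Y ∩ posOrthant N)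
    (hdual : ∀ v : Fin N → ℝ,
      fderiv ℝ negEntropy z v = fderiv ℝ negEntropy y v + η * ∑ i, g i * v i)
    (hmin : IsMinOn (fun w => bregman negEntropy w z) (Y ∩ posOrthant N) y') (hu : u ∈ Y) :
    η * ∑ i, g i * (u i - y i) ≤
      bregman negEntropy u y - bregman negEntropy u y' + N * (η ^ 2 * L ^ 2) := by
  have hbreg : HasFDerivAt (fun w => bregman negEntropy w z)
      (fderiv ℝ negEntropy y' - fderiv ℝ negEntropy z) y' := by
    have h1 := (hasFDerivAt_negEntropy hy'.2).differentiableAt.hasFDerivAt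
    have h2 : HasFDerivAt (fun w => fderiv ℝ negEntropy z (w - z)) (fderiv ℝ negEntropy z) y' :=
      (fderiv ℝ negEntropy z).hasFDerivAt.comp y' ((hasFDerivAt_id y').sub_const z)
    exact (h1.sub_const _).sub h2
  have hopt := IsMinOn.fderiv_sub_nonneg hY hy' hmin hbreg hu fun i => (hY1 u hu i).1
  simp only [sub_apply] at hopt
  have hd1 := hdual (u - y)
  have hd2 := hdual (u - y')
  simp only [Pi.sub_apply] at hd1 hd2
  have hlin : fderiv ℝ negEntropy y (u - y) =
      fderiv ℝ negEntropy y (u - y') + fderiv ℝ negEntropy y (y' - y) := by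
    rw [← map_add]; congr 1; abel
  -- the displacement `y' - y` is paid by the divergence between `y'` and `y`
  have hdisp : η * ∑ i, g i * (y' i - y i) - bregman negEntropy y' y ≤ N * (η ^ 2 * L ^ 2) := by
    rw [bregman_negEntropy hy.2, Finset.mul_sum, ← Finset.sum_sub_distrib]
    have hterm : ∀ i ∈ Finset.univ, η * (g i * (y' i - y i)) -
        (y' i * Real.log (y' i) - y i * Real.log (y i) -
          (Real.log (y i) + 1) * (y' i - y i)) ≤ η ^ 2 * L ^ 2 := by
      intro i _
      have h1 := mul_log_bregman_ge (hY1 y' hy'.1 i) (hy.2 i) (hY1 y hy.1 i).2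
      have h2 : g i ^ 2 ≤ L ^ 2 := sq_le_sq' (abs_le.1 (hg i)).1 (abs_le.1 (hg i)).2
      nlinarith [sq_nonneg (η * g i - (y' i - y i) / 2),
        mul_le_mul_of_nonneg_left h2 (sq_nonneg η)]
    simpa using Finset.sum_le_card_nsmul _ _ _ hterm
  have hsplit : ∑ i, g i * (u i - y i) =
      ∑ i, g i * (u i - y' i) + ∑ i, g i * (y' i - y i) := by
    rw [← Finset.sum_add_distrib]
    exact Finset.sum_congr rfl fun i _ => by ring
  rw [hsplit, mul_add]
  simp only [bregman] at hdisp ⊢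
  linarith

/-- The divergence from the initial point is bounded, since `y` minimizes the negative entropy. -/
lemma bregman_negEntropy_init_le {Y : Set (Fin N → ℝ)} (hY : Convex ℝ Y)
    (hY1 : ∀ y ∈ Y, ∀ i, y i ∈ Set.Icc (0 : ℝ) 1) {y u : Fin N → ℝ}
    (hy : y ∈ Y ∩ posOrthant N) (hmin : IsMinOn negEntropy (Y ∩ posOrthant N) y) (hu : u ∈ Y) :
    bregman negEntropy u y ≤ N := by
  have hopt := IsMinOn.fderiv_sub_nonneg hY hy hmin
    (hasFDerivAt_negEntropy hy.2).differentiableAt.hasFDerivAt hu fun i => (hY1 u hu i).1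
  have h : negEntropy u - negEntropy y ≤ N := by
    rw [negEntropy, negEntropy, ← Finset.sum_sub_distrib]
    have hterm : ∀ i ∈ Finset.univ, u i * Real.log (u i) - y i * Real.log (y i) ≤ 1 := by
      intro i _
      have h1 := Real.mul_log_nonpos (hY1 u hu i).1 (hY1 u hu i).2
      have h2 := mul_log_bregman_nonneg (hy.2 i).le one_pos
      simp at h2
      linarith [hy.2 i]
    simpa using Finset.sum_le_card_nsmul _ _ _ hterm
  rw [bregman]
  linarith

/-- The averaged iterate of entropic mirror ascent is nearly optimal. -/
lemma IsMirrorAscentRun.le_averageIterate {Y : Set (Fin N → ℝ)} (hY : Convex ℝ Y)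
    (hY1 : ∀ y ∈ Y, ∀ i, y i ∈ Set.Icc (0 : ℝ) 1) {F : (Fin N → ℝ) → ℝ} {L : ℝ}
    (hconc : ConcaveOn ℝ Set.univ F) (hF : ∀ y y', F y - F y' ≤ L * ∑ o, |y o - y' o|)
    {η : ℝ} (hη : 0 < η) {n : ℕ} (hn : 1 ≤ n) {y z g : ℕ → Fin N → ℝ}
    (hrun : IsMirrorAscentRun negEntropy (posOrthant N) Y η F n y z g) {u : Fin N → ℝ}
    (hu : u ∈ Y) :
    F u - (N / (n * η) + N * (η * L ^ 2)) ≤ F (averageIterate n y) := by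
  have hn0 : (0 : ℝ) < n := by exact_mod_cast hn
  have hmem : ∀ t, t ≤ n → y (t + 1) ∈ Y ∩ posOrthant N := by
    intro t ht
    rcases Nat.eq_zero_or_pos t with rfl | h
    · exact hrun.init_mem
    · exact hrun.proj_mem t ⟨h, ht⟩
  have hstep : ∀ t < n, η * (F u - F (y (t + 1))) ≤
      bregman negEntropy u (y (t + 1)) - bregman negEntropy u (y (t + 2)) +
        N * (η ^ 2 * L ^ 2) := by
    intro t ht
    have htn : t + 1 ∈ Set.Icc 1 n := ⟨by omega, by omega⟩
    have hsub := hrun.subgradient (t + 1) htn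
    refine le_trans (mul_le_mul_of_nonneg_left ?_ hη.le)
      (mirror_step hY hY1 (hsub.abs_le hF) (hmem t ht.le)
        (hrun.proj_mem _ htn) (hrun.dual_step _ htn) (hrun.proj_min _ htn) hu)
    linarith [hsub u]
  have hsum : η * ∑ t ∈ Finset.range n, (F u - F (y (t + 1))) ≤
      bregman negEntropy u (y 1) - bregman negEntropy u (y (n + 1)) +
        n * (N * (η ^ 2 * L ^ 2)) := by
    rw [Finset.mul_sum]
    refine (Finset.sum_le_sum fun t ht => hstep t (Finset.mem_range.1 ht)).trans ?_
    rw [Finset.sum_add_distrib,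
      Finset.sum_range_sub' (fun t => bregman negEntropy u (y (t + 1)))]
    simp
  have hinit := bregman_negEntropy_init_le hY hY1 hrun.init_mem hrun.init_min hu
  have hlast := bregman_negEntropy_nonneg (fun i => (hY1 u hu i).1) (hmem n le_rfl).2
  have havg : (1 / (n : ℝ)) * ∑ t ∈ Finset.range n, F (y (t + 1)) ≤ F (averageIterate n y) := by
    have h := hconc.le_map_sum (t := Finset.range n) (w := fun _ => 1 / (n : ℝ))
      (p := fun t => y (t + 1)) (fun _ _ => by positivity)
      (by simp; field_simp) (fun _ _ => Set.mem_univ _)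
    have he : averageIterate n y = ∑ t ∈ Finset.range n, (1 / (n : ℝ)) • y (t + 1) := by
      ext i
      rw [averageIterate, Finset.sum_apply, Finset.mul_sum, ← Finset.Ico_add_one_right_eq_Icc,
        Finset.sum_Ico_eq_sum_range]
      simp [add_comm]
    rw [he, Finset.mul_sum]
    simpa using h
  refine le_trans ?_ havg
  rw [Finset.sum_sub_distrib] at hsum
  simp only [Finset.sum_const, Finset.card_range, nsmul_eq_mul] at hsum
  set A := ∑ t ∈ Finset.range n, F (y (t + 1))
  have hfin : η * (n * F u - A) ≤ N + n * (N * (η ^ 2 * L ^ 2)) := by linarith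
  have key : F u - (N / (n * η) + N * (η * L ^ 2)) - 1 / (n : ℝ) * A =
      (η * (n * F u - A) - (N + n * (N * (η ^ 2 * L ^ 2)))) / (n * η) := by
    field_simp
    ring
  have : (η * (n * F u - A) - (N + n * (N * (η ^ 2 * L ^ 2)))) / (n * η) ≤ 0 :=
    div_nonpos_of_nonpos_of_nonneg (by linarith) (by positivity)
  linarith

lemma averageIterate_mem {Y : Set (Fin N → ℝ)} (hY : Convex ℝ Y) {n : ℕ} (hn : 1 ≤ n)
    {y : ℕ → Fin N → ℝ} (hy : ∀ t ∈ Finset.Icc 1 n, y t ∈ Y) : averageIterate n y ∈ Y := by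
  have hn0 : (0 : ℝ) < n := by exact_mod_cast hn
  have he : averageIterate n y = ∑ t ∈ Finset.Icc 1 n, (1 / (n : ℝ)) • y t := by
    ext i
    simp [averageIterate, Finset.sum_apply, Finset.mul_sum]
  rw [he]
  exact hY.sum_mem (fun _ _ => by positivity) (by simp; field_simp) hy

end mirror

/-! ### The approximation guarantee -/

namespace SimilarityCache

variable {R : Type*} {N : ℕ} (S : SimilarityCache R N)

lemma fracStates_subset :
    S.fracStates ⊆ {y | (∀ i, y i ∈ Set.Icc (0 : ℝ) 1) ∧ ∑ i, y i = (S.h : ℝ)} := by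
  refine convexHull_min ?_ ?_
  · rintro _ ⟨b, hb, rfl⟩
    exact ⟨boolVec_mem_Icc b, hb⟩
  · intro y hy y' hy' a a' ha ha' haa
    refine ⟨fun i => (convex_Icc (0 : ℝ) 1) (hy.1 i) (hy'.1 i) ha ha' haa, ?_⟩
    simp only [Pi.add_apply, Pi.smul_apply, smul_eq_mul, Finset.sum_add_distrib,
      ← Finset.mul_sum]
    rw [hy.2, hy'.2, ← add_mul, haa, one_mul]

/-- If the whole catalog fits in the cache, there is only one valid state. -/
lemma fracStates_subsingleton (h : S.h = N) : S.fracStates.Subsingleton := by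
  have hone : ∀ y ∈ S.fracStates, ∀ i, y i = 1 := by
    intro y hy i
    obtain ⟨h1, h2⟩ := S.fracStates_subset hy
    have h3 : ∑ i, (1 - y i) = 0 := by
      rw [Finset.sum_sub_distrib, h2, h]
      simp
    have := (Finset.sum_eq_zero_iff_of_nonneg fun i _ => sub_nonneg.2 (h1 i).2).1 h3 i
      (Finset.mem_univ i)
    linarith
  intro y hy y' hy'
  ext i
  rw [hone y hy i, hone y' hy' i]

/-- The average iterate of the algorithm is `δ`-optimal after sufficiently many iterations: the
learning rate is `c / √n` with a constant `c`, which is positive unless there is only one state. -/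
lemma exists_le_avgFracGain_averageIterate {c : ℝ}
    (hc : S.IsKthDissimilarityBound c) {T : ℕ} (hT : 1 ≤ T) (r : Fin T → R) {u : Fin N → ℝ}
    (hu : u ∈ S.fracStates) {δ : ℝ} (hδ : 0 < δ) :
    ∃ n₀ : ℕ, ∀ n : ℕ, n₀ ≤ n → 1 ≤ n → ∀ y z g : ℕ → Fin N → ℝ,
      IsMirrorAscentRun negEntropy (posOrthant N) S.fracStates
        (1 / (c + S.cf) * Real.sqrt (2 * Real.log ((N : ℝ) / (S.h : ℝ)) / (n : ℝ)))
        (S.avgFracGain r) n y z g →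
      averageIterate n y ∈ S.fracStates ∧
        S.avgFracGain r u - δ ≤ S.avgFracGain r (averageIterate n y) := by
  have hY : Convex ℝ S.fracStates := convex_convexHull ℝ _
  have hmem : ∀ {n : ℕ} {η : ℝ} {y z g : ℕ → Fin N → ℝ}, 1 ≤ n →
      IsMirrorAscentRun negEntropy (posOrthant N) S.fracStates η (S.avgFracGain r) n y z g →
      averageIterate n y ∈ S.fracStates := by
    intro n η y z g hn hrun
    refine averageIterate_mem hY hn fun t ht => ?_
    rw [Finset.mem_Icc] at ht
    obtain ⟨s, rfl⟩ : ∃ s, t = s + 1 := ⟨t - 1, by omega⟩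
    rcases Nat.eq_zero_or_pos s with rfl | hs
    · exact hrun.init_mem.1
    · exact (hrun.proj_mem s ⟨hs, by omega⟩).1
  rcases S.h_le.eq_or_lt with hN | hN
  · refine ⟨1, fun n _ hn y z g hrun => ⟨hmem hn hrun, ?_⟩⟩
    rw [S.fracStates_subsingleton hN (hmem hn hrun) hu]
    linarith
  have hY1 : ∀ y ∈ S.fracStates, ∀ i, y i ∈ Set.Icc (0 : ℝ) 1 :=
    fun y hy => (S.fracStates_subset hy).1
  obtain ⟨L, hL⟩ := S.exists_lipschitz_avgFracGain r
  have hc0 : 0 ≤ c := by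
    obtain ⟨o, ho⟩ := Finset.card_pos.1 (S.one_le_k.trans (hc (r ⟨0, hT⟩)))
    exact (S.cd_nonneg _ o).trans (Finset.mem_filter.1 ho).2
  have hh : (0 : ℝ) < S.h := by exact_mod_cast S.one_le_h
  have hlog : 0 < Real.log ((N : ℝ) / S.h) :=
    Real.log_pos ((one_lt_div hh).2 (by exact_mod_cast hN))
  set a := 1 / (c + S.cf) * √(2 * Real.log ((N : ℝ) / S.h)) with ha
  have ha0 : 0 < a := mul_pos (one_div_pos.2 (by linarith [S.cf_pos]))
    (Real.sqrt_pos.2 (by linarith))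
  set B : ℝ := N / a + N * (a * L ^ 2) with hB
  have hB0 : 0 ≤ B := by positivity
  refine ⟨⌈(B / δ) ^ 2⌉₊, fun n hn hn1 y z g hrun => ⟨hmem hn1 hrun, ?_⟩⟩
  have hn0 : (0 : ℝ) < n := by exact_mod_cast hn1
  have hs0 : 0 < √(n : ℝ) := Real.sqrt_pos.2 hn0
  have hη : 1 / (c + S.cf) * √(2 * Real.log ((N : ℝ) / S.h) / n) = a / √(n : ℝ) := by
    rw [Real.sqrt_div (by linarith), ha]
    ring
  rw [hη] at hrun
  have hreg := hrun.le_averageIterate hY hY1 (S.concaveOn_avgFracGain r) hL (div_pos ha0 hs0) hn1 hu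
  have herr : (N : ℝ) / (n * (a / √(n : ℝ))) + N * (a / √(n : ℝ) * L ^ 2) = B / √(n : ℝ) := by
    have hsq : (n : ℝ) = √(n : ℝ) * √(n : ℝ) := (Real.mul_self_sqrt hn0.le).symm
    generalize √(n : ℝ) = s at *
    rw [hsq, hB]
    field_simp
  have hsmall : B / √(n : ℝ) ≤ δ := by
    rw [div_le_iff₀ hs0, mul_comm, ← div_le_iff₀ hδ]
    exact Real.le_sqrt_of_sq_le (Nat.ceil_le.1 hn)
  rw [herr] at hreg
  linarith

end SimilarityCache

end

theorem corollary1 {R : Type*} {N : ℕ} (S : SimilarityCache R N)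
    (cdk : ℝ) (hcdk : S.IsKthDissimilarityBound cdk)
    {T : ℕ} (hT : 1 ≤ T) (r : Fin T → R)
    (xstar : Fin N → Bool) (hxstar : S.IsBestStatic r xstar)
    (ε : ℝ) (hε : 0 < ε) :
    ∃ T₀ : ℕ, ∀ T' : ℕ, T₀ ≤ T' → 1 ≤ T' →
      ∀ y z g : ℕ → Fin N → ℝ,
        IsMirrorAscentRun negEntropy (posOrthant N) S.fracStates
          (1 / (cdk + S.cf) * Real.sqrt (2 * Real.log ((N : ℝ) / (S.h : ℝ)) / (T' : ℝ)))
          (S.avgFracGain r) T' y z g →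
        ∀ μ : PMF (Fin N → Bool),
          (IsDepRound (averageIterate T' y) μ ∨
            IsCoupledSample S.fracStates (averageIterate T' y) μ) →
          (1 - 1 / Real.exp 1 - ε) * S.avgGain r xstar ≤ expectation μ (S.avgGain r) := by
  have hu : boolVec xstar ∈ S.fracStates := subset_convexHull ℝ _ ⟨xstar, hxstar.1, rfl⟩
  have hY1 : ∀ y ∈ S.fracStates, ∀ i, y i ∈ Set.Icc (0 : ℝ) 1 :=
    fun y hy => (S.fracStates_subset hy).1
  have he0 : 0 < 1 / Real.exp 1 := by positivity
  have he1 : 1 / Real.exp 1 ≤ 1 := by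
    rw [div_le_one (Real.exp_pos 1)]
    exact Real.one_le_exp zero_le_one
  have hround : ∀ q ∈ S.fracStates, ∀ μ : PMF (Fin N → Bool),
      (IsDepRound q μ ∨ IsCoupledSample S.fracStates q μ) →
      (1 - 1 / Real.exp 1) * S.avgFracGain r q ≤ expectation μ (S.avgGain r) := by
    intro q hq μ hμ
    refine S.expectation_avgGain_ge r (hY1 q hq) ?_
    rcases hμ with h | h
    · exact h.dominatesCoins (hY1 q hq)
    · exact (h.dominatesCoins hY1).2
  rw [S.avgGain_eq_avgFracGain r xstar]
  have hopt : 0 ≤ S.avgFracGain r (boolVec xstar) :=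
    S.avgFracGain_nonneg r fun i => (hY1 _ hu i).1
  -- the additive error must be a fraction `ε` of the optimum, so a vanishing optimum is separate
  rcases hopt.eq_or_lt with h0 | hpos
  · obtain ⟨n₀, hn₀⟩ := S.exists_le_avgFracGain_averageIterate hcdk hT r hu one_pos
    refine ⟨n₀, fun n hn hn1 y z g hrun μ hμ => ?_⟩
    have hq := (hn₀ n hn hn1 y z g hrun).1
    rw [← h0, mul_zero]
    exact le_trans (mul_nonneg (by linarith)
      (S.avgFracGain_nonneg r fun i => (hY1 _ hq i).1)) (hround _ hq μ hμ)
  · obtain ⟨n₀, hn₀⟩ := S.exists_le_avgFracGain_averageIterate hcdk hT r hu (mul_pos hε hpos)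
    refine ⟨n₀, fun n hn hn1 y z g hrun μ hμ => ?_⟩
    obtain ⟨hq, hle⟩ := hn₀ n hn hn1 y z g hrun
    refine le_trans ?_ (hround _ hq μ hμ)
    have h1 := mul_le_mul_of_nonneg_left hle (sub_nonneg.2 he1)
    nlinarith [mul_pos he0 (mul_pos hε hpos)]
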